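/- Let $G$ be a totally disconnected, locally compact (Hausdorff) group, let $H$ be a closed subgroup of $G$, acting by conjugation, and let $K$ be a closed subgroup of $G$ normalized by $H$. Suppose that there is a closed normal subgroup $N$ of $H$ (possibly trivial) such that $H/N$ is compactly generated and $N$ has SIN action on $K$, i.e. every neighbourhood of $1$ in $K$ contains a neighbourhood of $1$ in $K$ that is invariant under conjugation by $N$. Notation. A subset of $K$ is $H$-invariant if every $h\in H$ conjugates it onto itself. For a closed $H$-invariant subgroup $D\le K$, a pair $(xD,yD)$ of points of $K/D$ is proximal if the closure in $K/D\times K/D$ of its orbit under the diagonal action of $H$ contains a point $(z,z)$; $H$ acts distally on $K/D$ if there is no proximal pair of distinct points, and distally at $1$ if there is no proximal pair $(xD,D)$ with $xD\ne D$. * $\mathrm{Dist}_K(H)$ (respectively $\mathrm{Dist}^*_K(H)$) is the intersection of all closed $H$-invariant subgroups $D$ of $K$ such that $H$ acts distally (respectively distally at $1$) on $K/D$. * For an $H$-invariant subgroup $L\le K$, $\mathrm{Res}_L(H)$ is the intersection of all $H$-invariant subgroups of $L$ that are open in $L$. Put $\mathrm{Res}^0_K(H)=K$, $\mathrm{Res}^{\alpha+1}_K(H)=\mathrm{Res}_{\mathrm{Res}^\alpha_K(H)}(H)$,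 and $\mathrm{Res}^{\alpha}_K(H)=\bigcap_{\beta<\alpha}\mathrm{Res}^\beta_K(H)$ for limit ordinals $\alpha>0$; $\mathrm{Res}^\infty_K(H)$ is the eventual value of this descending series. * A compact open subgroup $U$ of $K$ is tidy for an automorphism $\alpha$ of $K$ if $U=U_+U_-$, where $U_+=\bigcap_{n\ge0}\alpha^n(U)$ and $U_-=\bigcap_{n\le0}\alpha^n(U)$, and the set $U_{++}=\{g\in K : \alpha^n(g)\in U \text{ for all sufficiently negative } n\}$ is closed. The action of $H$ on $K$ is flat if some compact open subgroup of $K$ is tidy for (conjugation by) every $h\in H$; in that case $\mathrm{nub}_K(H)$ is the intersection of all such subgroups. Then the following are equivalent: (i) $\mathrm{Dist}_K(H)$ is compact; (ii) $\mathrm{Res}_K(H)$ is compact; (iii) $H$ normalizes a compact open subgroup of $K$. Moreover, if any of these conditions holds, then $H$ is flat on $K$ and $$\mathrm{nub}_K(H)=\mathrm{Res}_K(H)=\mathrm{Res}^\infty_K(H)=\mathrm{Dist}_K(H),$$ the group $\mathrm{nub}_K(H)$ is $H$-invariant and $H$ acts ergodically on it with respect to Haar measure $\mu$ (the action preserves $\mu$,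 and every Borel set $A$ with $\mu(hAh^{-1}\mathbin{\triangle}A)=0$ for all $h\in H$ is null or conull); and if $\mathrm{nub}_K(H)$ is metrizable, then $\mathrm{nub}_K(H)=\mathrm{Dist}^*_K(H)$. -/

import Mathlib

/-!
Throughout, a group `H` acts on a topological group `K` by automorphisms through a homomorphism
`φ : H →* MulAut K`.  In the theorem `K` is a closed subgroup of a t.d.l.c. group and `φ` is the
conjugation action of a subgroup normalizing `K`, so every `φ h` is a homeomorphism.
-/

namespace TDLC

open Filter Topology MeasureTheory
open scoped Pointwise

/-- The conjugation action `h ↦ (k ↦ h k h⁻¹)` on `K` of a subgroup `H` normalizing `K`. -/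
def conjAction {G : Type*} [Group G] (H K : Subgroup G)
    (hHK : H ≤ Subgroup.normalizer (K : Set G)) : H →* MulAut K :=
  K.normalizerMonoidHom.comp (Subgroup.inclusion hHK)

/-- A topological group is compactly generated if it is generated, as an abstract group, by a
compact subset. -/
def IsCompactlyGenerated (Q : Type*) [Group Q] [TopologicalSpace Q] : Prop :=
  ∃ S : Set Q, IsCompact S ∧ Subgroup.closure S = ⊤

section Tidy

variable {K : Type*} [Group K]

/-- `U₊ = ⋂_{n ≥ 0} αⁿ(U)`. -/
def plusPart (α : MulAut K) (U : Subgroup K) : Subgroup K :=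
  ⨅ n : ℕ, U.map (α ^ n).toMonoidHom

/-- `U₋ = ⋂_{n ≤ 0} αⁿ(U)`. -/
def minusPart (α : MulAut K) (U : Subgroup K) : Subgroup K :=
  ⨅ n : ℕ, U.map (α⁻¹ ^ n).toMonoidHom

/-- `U₊₊`, the set of `g` such that `αⁿ(g) ∈ U` for all sufficiently negative integers `n`. -/
def plusPlusPart (α : MulAut K) (U : Subgroup K) : Set K :=
  {g | ∃ m : ℤ, ∀ n : ℤ, n ≤ m → (α ^ n) g ∈ U}

/-- A compact open subgroup `U` is tidy for `α` if it is tidy above (`U = U₊ U₋`) and tidy below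
(`U₊₊` is closed). -/
structure IsTidy [TopologicalSpace K] (α : MulAut K) (U : Subgroup K) : Prop where
  isCompact : IsCompact (U : Set K)
  isOpen : IsOpen (U : Set K)
  tidyAbove : (U : Set K) = (plusPart α U : Set K) * (minusPart α U : Set K)
  tidyBelow : IsClosed (plusPlusPart α U)

end Tidy

section Action

variable {H K : Type*} [Group H] [Group K]

/-- A subset `X` is `H`-invariant: every element of `H` maps `X` onto itself. -/
def IsInvariant (φ : H →* MulAut K) (X : Set K) : Prop :=
  ∀ h : H, (φ h) '' X = X

/-- The action of `H` on an `H`-invariant subgroup. -/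
abbrev smulOn (φ : H →* MulAut K) (L : Subgroup K) (hL : IsInvariant φ (L : Set K)) : SMul H L where
  smul h x := ⟨φ h x, by
    have hx : φ h x ∈ (φ h) '' (L : Set K) := ⟨x, x.2, rfl⟩
    rwa [hL h] at hx⟩

variable [TopologicalSpace K]

/-- The action has small invariant neighbourhoods (SIN): there are arbitrarily small `H`-invariant
neighbourhoods of the identity. -/
def HasSIN (φ : H →* MulAut K) : Prop :=
  ∀ V ∈ 𝓝 (1 : K), ∃ W ∈ 𝓝 (1 : K), W ⊆ V ∧ IsInvariant φ W

/-- `U` is tidy for (every automorphism induced by) `H`. -/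
def IsTidyFor (φ : H →* MulAut K) (U : Subgroup K) : Prop :=
  ∀ h : H, IsTidy (φ h) U

/-- The action is flat: some compact open subgroup is tidy for `H`. -/
def IsFlat (φ : H →* MulAut K) : Prop :=
  ∃ U : Subgroup K, IsTidyFor φ U

/-- The nub of a flat action: the intersection of all subgroups that are tidy for `H`. -/
def nub (φ : H →* MulAut K) : Subgroup K :=
  sInf {U : Subgroup K | IsTidyFor φ U}

/-- For an `H`-invariant subgroup `D`, the pair of cosets `(xD, yD)` is proximal for the action
`h • xD = φ(h)(x)D` of `H` on `K/D`: the closure of its orbit under the diagonal action meets the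
diagonal of `K/D × K/D`. -/
def IsProximal (φ : H →* MulAut K) (D : Subgroup K) (x y : K) : Prop :=
  ∃ z : K ⧸ D, (z, z) ∈ closure
    (Set.range fun h : H => ((φ h x : K ⧸ D), (φ h y : K ⧸ D)))

/-- `H` acts distally on `K/D`: there is no proximal pair of distinct points. -/
def IsDistalOn (φ : H →* MulAut K) (D : Subgroup K) : Prop :=
  ∀ x y : K, IsProximal φ D x y → (x : K ⧸ D) = (y : K ⧸ D)

/-- `H` acts distally at `1` on `K/D`: no non-trivial coset forms a proximal pair with the trivial
coset. -/
def IsDistalAtOneOn (φ : H →* MulAut K) (D : Subgroup K) : Prop :=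
  ∀ x : K, IsProximal φ D x 1 → (x : K ⧸ D) = ((1 : K) : K ⧸ D)

/-- The distal residual `Dist_K(H)`. -/
def distalResidual (φ : H →* MulAut K) : Subgroup K :=
  sInf {D : Subgroup K | IsClosed (D : Set K) ∧ IsInvariant φ (D : Set K) ∧ IsDistalOn φ D}

/-- The `1`-distal residual `Dist*_K(H)`. -/
def oneDistalResidual (φ : H →* MulAut K) : Subgroup K :=
  sInf {D : Subgroup K | IsClosed (D : Set K) ∧ IsInvariant φ (D : Set K) ∧ IsDistalAtOneOn φ D}

/-- The discrete residual `Res_L(H)` of `H` on an `H`-invariant subgroup `L` of `K`, as a subgroup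
of `K`: the intersection of all `H`-invariant subgroups of `L` that are open in `L`. -/
def discreteResidualOn (φ : H →* MulAut K) (L : Subgroup K) : Subgroup K :=
  sInf {U : Subgroup K | U ≤ L ∧ IsOpen (U.subgroupOf L : Set L) ∧ IsInvariant φ (U : Set K)}

/-- The discrete residual `Res_K(H)`: the intersection of all open `H`-invariant subgroups. -/
def discreteResidual (φ : H →* MulAut K) : Subgroup K :=
  sInf {U : Subgroup K | IsOpen (U : Set K) ∧ IsInvariant φ (U : Set K)}

/-- `H` acts ergodically on the `H`-invariant subgroup `L`, with respect to (any choice of) Haar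
measure on `L`. -/
def IsErgodicOn (φ : H →* MulAut K) (L : Subgroup K) : Prop :=
  ∃ hL : IsInvariant φ (L : Set K),
    ∀ [MeasurableSpace L] [BorelSpace L] (μ : Measure L) [μ.IsHaarMeasure] [μ.Regular],
      letI := smulOn φ L hL
      ErgodicSMul H L μ

end Action

section Transfinite

universe u v

variable {H : Type v} {K : Type u} [Group H] [Group K] [TopologicalSpace K]

/-- The transfinite series `Res^α_K(H)`: `Res^0 = K`, `Res^{α+1} = Res_{Res^α}(H)`, and
intersections at limit ordinals. -/
noncomputable def residualSeries (φ : H →* MulAut K) (α : Ordinal.{u}) : Subgroup K :=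
  Ordinal.limitRecOn (motive := fun _ => Subgroup K) α ⊤
    (fun _ L => discreteResidualOn φ L)
    (fun α _ F => ⨅ (β : Ordinal.{u}) (hβ : β < α), F β hβ)

/-- `Res^∞_K(H)`: the eventual value of the descending series `Res^α_K(H)`, that is, the
intersection of all its terms (the series is stationary from some ordinal in the universe of `K`
on, since `K` has only a set of subgroups). -/
noncomputable def residualInfty (φ : H →* MulAut K) : Subgroup K :=
  ⨅ α : Ordinal.{u}, residualSeries φ α

end Transfinite

end TDLC

/-!
Lifting a compact generating set of `H ⧸ N` gives a symmetric generating set `S` of `H` that acts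
equicontinuously at `1`, since conjugation by `N` can be absorbed into small invariant
neighbourhoods. Fix a compact open subgroup `U` of `K` and let `Uₙ` consist of the `x` that all
products of `n` elements of `S` keep inside `U`; each `Uₙ` is open, and `⋂ Uₙ` is the invariant core
`C` of `U`.

* `Res = Dist` when `Dist` is compact. If `C` is not open then no `Uₙ` equals `Uₙ₊₁`, and
  compactness of `U \ U₁` yields `y ∉ C` with an orbit closure meeting `C`. If moreover `D ≤ C`
  and the action on `K ⧸ D` is distal, then every element of the Ellis semigroup of the compact
  space `C ⧸ D` is surjective, so `yD` is proximal to some point of `C ⧸ D` and hence `y ∈ C`, a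
  contradiction. So the cores of the compact open subgroups containing `Dist` are open, and they
  intersect in `Dist`.
* If `Res` is compact and contained in `U`, then some open invariant subgroup avoids the compact
  set `U \ U₁`; its intersection with `U` is invariant. Hence `Res` has arbitrarily small compact
  open invariant neighbourhoods, and the same argument shows that `Res` has no proper relatively
  open invariant subgroup, which makes the series `Res^α` stationary at `Res`.
* A compact open invariant subgroup is tidy. Conversely, if there is a compact open invariant
  subgroup `W`, then for `U` tidy `U₊₊ ∩ W` is compact, so by Baire's theorem it is commensurate
  to `U₊`; comparing indices gives `α(U₊) = U₊`, and then `α(U) = U`. So `nub = Res`.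
* Ergodicity. If a Borel subset `A` of `Res` is almost invariant, then `r ↦ μ(rA ∆ A)` is
  continuous and `H`-invariant, so its zero set, a closed subgroup, is an intersection of open
  invariant subgroups and therefore everything; thus `A` is null or conull.
* If `Res` is metrizable, ergodicity makes almost every orbit dense, so almost every `x` is
  proximal to `1`, and `Res` lies in every closed `D` for which the action on `K ⧸ D` is distal at
  `1`.
-/

namespace TDLC

open Filter Topology MeasureTheory
open scoped Pointwise

section Invariance

variable {H K : Type*} [Group H] [Group K] {φ : H →* MulAut K}

lemma isInvariant_iff {X : Set K} : IsInvariant φ X ↔ ∀ h, ∀ x ∈ X, φ h x ∈ X := by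
  refine ⟨fun hX h x hx => ?_, fun hX h => ?_⟩
  · rw [← hX h]
    exact Set.mem_image_of_mem _ hx
  · refine Set.Subset.antisymm (Set.image_subset_iff.2 fun x hx => hX h x hx) fun x hx => ?_
    exact ⟨φ h⁻¹ x, hX _ _ hx, by rw [map_inv, MulAut.apply_inv_self]⟩

lemma IsInvariant.apply_mem {X : Set K} (hX : IsInvariant φ X) (h : H) {x : K} (hx : x ∈ X) :
    φ h x ∈ X :=
  isInvariant_iff.1 hX h x hx

lemma isInvariant_univ : IsInvariant φ Set.univ :=
  isInvariant_iff.2 fun _ _ _ => Set.mem_univ _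

lemma IsInvariant.sInf {𝒮 : Set (Subgroup K)}
    (h𝒮 : ∀ U ∈ 𝒮, IsInvariant φ (U : Set K)) : IsInvariant φ ((sInf 𝒮 : Subgroup K) : Set K) := by
  refine isInvariant_iff.2 fun h x hx => ?_
  simp only [SetLike.mem_coe, Subgroup.mem_sInf] at hx ⊢
  exact fun U hU => (h𝒮 U hU).apply_mem h (hx U hU)

lemma IsInvariant.inf {U V : Subgroup K} (hU : IsInvariant φ (U : Set K))
    (hV : IsInvariant φ (V : Set K)) : IsInvariant φ ((U ⊓ V : Subgroup K) : Set K) :=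
  isInvariant_iff.2 fun h _ hx => ⟨hU.apply_mem h hx.1, hV.apply_mem h hx.2⟩

lemma IsInvariant.map_eq {W : Subgroup K} (hW : IsInvariant φ (W : Set K)) (h : H) :
    W.map (φ h).toMonoidHom = W :=
  SetLike.coe_injective (hW h)

/-- The largest `H`-invariant subgroup contained in `U`. -/
def invariantCore (φ : H →* MulAut K) (U : Subgroup K) : Subgroup K :=
  ⨅ h : H, U.comap (φ h).toMonoidHom

lemma mem_invariantCore {U : Subgroup K} {x : K} :
    x ∈ invariantCore φ U ↔ ∀ h, φ h x ∈ U := by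
  simp [invariantCore, Subgroup.mem_iInf]

lemma invariantCore_le (U : Subgroup K) : invariantCore φ U ≤ U := fun x hx => by
  simpa using mem_invariantCore.1 hx 1

lemma isInvariant_invariantCore (U : Subgroup K) :
    IsInvariant φ (invariantCore φ U : Set K) := by
  refine isInvariant_iff.2 fun h x hx => mem_invariantCore.2 fun g => ?_
  simpa using mem_invariantCore.1 hx (g * h)

lemma le_invariantCore {U D : Subgroup K} (hD : IsInvariant φ (D : Set K)) (hDU : D ≤ U) :
    D ≤ invariantCore φ U :=
  fun _ hx => mem_invariantCore.2 fun h => hDU (hD.apply_mem h hx)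

lemma isClosed_invariantCore [TopologicalSpace K] (hφ : ∀ h, Continuous (φ h)) {U : Subgroup K}
    (hU : IsClosed (U : Set K)) : IsClosed (invariantCore φ U : Set K) := by
  have hcore : (invariantCore φ U : Set K) = ⋂ h, (φ h) ⁻¹' U := by
    ext x
    simp [mem_invariantCore]
  rw [hcore]
  exact isClosed_iInter fun h => hU.preimage (hφ h)

end Invariance

section Generation

variable {H K : Type*} [Group H] [Group K] [TopologicalSpace K]

/-- `S` is a symmetric generating set of `H` that contains `1` and acts on `K` equicontinuously at
`1`, for example the preimage of a compact symmetric generating set of `H ⧸ N` containing `1`, where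
`N` has SIN action on `K`. -/
structure IsEquicontinuousGenerating (φ : H →* MulAut K) (S : Set H) : Prop where
  one_mem : 1 ∈ S
  inv_eq : S⁻¹ = S
  closure_eq_top : Subgroup.closure S = ⊤
  mem_nhds_one : ∀ V ∈ 𝓝 (1 : K), {k | ∀ s ∈ S, φ s k ∈ V} ∈ 𝓝 (1 : K)

variable {φ : H →* MulAut K} {S : Set H}

namespace IsEquicontinuousGenerating

lemma inv_mem_pow (hS : IsEquicontinuousGenerating φ S) {n : ℕ} {g : H} (hg : g ∈ S ^ n) :
    g⁻¹ ∈ S ^ n := by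
  rwa [← Set.mem_inv, ← inv_pow, hS.inv_eq]

lemma exists_mem_pow (hS : IsEquicontinuousGenerating φ S) (h : H) : ∃ n, h ∈ S ^ n := by
  have hh : h ∈ Subgroup.closure S := hS.closure_eq_top ▸ Subgroup.mem_top h
  induction hh using Subgroup.closure_induction with
  | mem s hs => exact ⟨1, by simpa using hs⟩
  | inv s _ hs => exact hs.imp fun n hn => hS.inv_mem_pow hn
  | one => exact ⟨0, by simp⟩
  | mul a b _ _ ha hb =>
    obtain ⟨m, hm⟩ := ha
    obtain ⟨n, hn⟩ := hb
    exact ⟨m + n, pow_add S m n ▸ Set.mul_mem_mul hm hn⟩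

lemma isInvariant (hS : IsEquicontinuousGenerating φ S) {X : Set K}
    (hX : ∀ s ∈ S, ∀ x ∈ X, φ s x ∈ X) : IsInvariant φ X := by
  refine isInvariant_iff.2 fun h => ?_
  obtain ⟨n, hn⟩ := hS.exists_mem_pow h
  induction n generalizing h with
  | zero => simp_all
  | succ n ih =>
    obtain ⟨a, ha, s, hs, rfl⟩ := pow_succ S n ▸ hn
    exact fun x hx => by simpa using ih a ha _ (hX s hs x hx)

lemma pow_mem_nhds_one (hS : IsEquicontinuousGenerating φ S) (n : ℕ) {V : Set K}
    (hV : V ∈ 𝓝 (1 : K)) : {k | ∀ s ∈ S ^ n, φ s k ∈ V} ∈ 𝓝 (1 : K) := by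
  induction n with
  | zero => simpa using hV
  | succ n ih =>
    refine mem_of_superset (hS.mem_nhds_one _ ih) fun k hk g hg => ?_
    obtain ⟨a, ha, s, hs, rfl⟩ := pow_succ S n ▸ hg
    simpa using hk s hs a ha

lemma continuous [IsTopologicalGroup K] (hS : IsEquicontinuousGenerating φ S) (h : H) :
    Continuous (φ h) := by
  obtain ⟨n, hn⟩ := hS.exists_mem_pow h
  refine continuous_of_continuousAt_one (φ h) (tendsto_def.2 fun V hV => ?_)
  rw [map_one] at hV
  exact mem_of_superset (hS.pow_mem_nhds_one n hV) fun k hk => hk h hn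

end IsEquicontinuousGenerating

variable [TopologicalSpace H] [IsTopologicalGroup H]

-- Near `h` the action is controlled by joint continuity at `(h, 1)`; passing from `h` to its coset
-- costs nothing because the neighbourhood of `1` may be chosen `N`-invariant.
lemma HasSIN.setOf_forall_mem_nhds_one {N : Subgroup H} (hSIN : HasSIN (φ.comp N.subtype))
    (hφ : Continuous fun q : H × K => φ q.1 q.2) {C : Set (H ⧸ N)} (hC : IsCompact C)
    {V : Set K} (hV : V ∈ 𝓝 1) : {k | ∀ h : H, (h : H ⧸ N) ∈ C → φ h k ∈ V} ∈ 𝓝 (1 : K) := by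
  refine hC.induction_on (by simp)
    (fun s t hst ht => mem_of_superset ht fun k hk h hh => hk h (hst hh))
    (fun s t hs ht => ?_) fun x _ => ?_
  · filter_upwards [hs, ht] with k hks hkt h hh
    exact hh.elim (hks h) (hkt h)
  · obtain ⟨h, rfl⟩ := QuotientGroup.mk_surjective x
    have hpre : (fun q : H × K => φ q.1 q.2) ⁻¹' V ∈ 𝓝 (h, (1 : K)) :=
      hφ.continuousAt.preimage_mem_nhds (by simpa using hV)
    obtain ⟨A, hA, B, hB, hAB⟩ := mem_nhds_prod_iff.1 hpre
    obtain ⟨W, hW, hWB, hWinv⟩ := hSIN B hB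
    refine ⟨_, mem_nhdsWithin_of_mem_nhds (QuotientGroup.isOpenMap_coe.image_mem_nhds hA),
      mem_of_superset hW ?_⟩
    rintro k hk g ⟨a, ha, hag⟩
    have hmem : φ (a⁻¹ * g) k ∈ W := hWinv.apply_mem ⟨a⁻¹ * g, QuotientGroup.eq.1 hag⟩ hk
    have hgk : φ a (φ (a⁻¹ * g) k) ∈ V := hAB (Set.mk_mem_prod ha (hWB hmem))
    rwa [← MulAut.mul_apply, ← map_mul, mul_inv_cancel_left] at hgk

lemma exists_isEquicontinuousGenerating (hφ : Continuous fun q : H × K => φ q.1 q.2)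
    (N : Subgroup H) [N.Normal] (hSIN : HasSIN (φ.comp N.subtype))
    (hcg : IsCompactlyGenerated (H ⧸ N)) : ∃ S : Set H, IsEquicontinuousGenerating φ S := by
  obtain ⟨C, hC, hCtop⟩ := hcg
  let T : Set (H ⧸ N) := C ∪ C⁻¹ ∪ {1}
  have hT : IsCompact T := (hC.union hC.inv).union isCompact_singleton
  have hTinv : T⁻¹ = T := by simp [T, Set.union_comm C]
  refine ⟨QuotientGroup.mk' N ⁻¹' T, by simp [T], ?_, ?_, fun V hV =>
    hSIN.setOf_forall_mem_nhds_one hφ hT hV⟩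
  · ext h
    rw [Set.mem_inv, Set.mem_preimage, Set.mem_preimage, map_inv, ← Set.mem_inv, hTinv]
  · have hker : (QuotientGroup.mk' N).ker ≤ Subgroup.closure (QuotientGroup.mk' N ⁻¹' T) :=
      fun h hh => Subgroup.subset_closure (by simp_all [T])
    rw [← Subgroup.comap_map_eq_self hker, MonoidHom.map_closure,
      Set.image_preimage_eq _ (QuotientGroup.mk'_surjective N), Subgroup.closure_union,
      Subgroup.closure_union, hCtop, top_sup_eq, top_sup_eq, Subgroup.comap_top]

end Generation

section CompactOpen

variable {K : Type*} [Group K] [TopologicalSpace K] [IsTopologicalGroup K]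

lemma isOpen_stabilizer_of_isCompact_of_isOpen {C : Set K} (hC : IsCompact C) (hO : IsOpen C) :
    IsOpen (MulAction.stabilizer K C : Set K) := by
  obtain ⟨V, hV, hVC⟩ := compact_open_separated_mul_left hC hO subset_rfl
  refine Subgroup.isOpen_of_mem_nhds _ (g := 1) ?_
  filter_upwards [hV, inv_mem_nhds_one K hV] with g hg hg'
  rw [SetLike.mem_coe, MulAction.mem_stabilizer_iff]
  refine Set.Subset.antisymm ?_ fun c hc =>
    ⟨g⁻¹ * c, hVC (Set.mul_mem_mul hg' hc), by simp⟩
  rintro _ ⟨c, hc, rfl⟩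
  exact hVC (Set.mul_mem_mul hg hc)

variable [LocallyCompactSpace K] [TotallyDisconnectedSpace K]

-- The stabilizer of `D * W` under left translation, for a small compact open `W` containing `1`.
lemma exists_isCompact_isOpen_subgroup_subset {D : Subgroup K} (hD : IsCompact (D : Set K))
    {O : Set K} (hO : IsOpen O) (hDO : (D : Set K) ⊆ O) :
    ∃ U : Subgroup K, IsCompact (U : Set K) ∧ IsOpen (U : Set K) ∧ D ≤ U ∧ (U : Set K) ⊆ O := by
  obtain ⟨V, hV, hDV⟩ := compact_open_separated_mul_right hD hO hDO
  obtain ⟨B, hB, hB1⟩ := exists_compact_mem_nhds (1 : K)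
  obtain ⟨W, hW, hW1, hWVB⟩ := loc_compact_Haus_tot_disc_of_zero_dim.mem_nhds_iff.1
    (inter_mem hV hB1)
  have hWc : IsCompact W := hB.of_isClosed_subset hW.isClosed (hWVB.trans Set.inter_subset_right)
  have hDW : IsCompact ((D : Set K) * W) := hD.mul hWc
  have hUo := isOpen_stabilizer_of_isCompact_of_isOpen hDW hW.isOpen.mul_left
  have hUDW : (MulAction.stabilizer K ((D : Set K) * W) : Set K) ⊆ D * W := by
    intro g hg
    have hone : (1 : K) ∈ (D : Set K) * W := ⟨1, D.one_mem, 1, hW1, by simp⟩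
    simpa [MulAction.mem_stabilizer_iff.1 hg] using Set.smul_mem_smul_set (a := g) hone
  refine ⟨_, hDW.of_isClosed_subset (Subgroup.isClosed_of_isOpen _ hUo) hUDW, hUo, fun d hd => ?_,
    hUDW.trans ((Set.mul_subset_mul_left (hWVB.trans Set.inter_subset_left)).trans hDV)⟩
  rw [MulAction.mem_stabilizer_iff, ← smul_mul_assoc, smul_coe_set hd]

lemma exists_isCompact_isOpen_subgroup_notMem {D : Subgroup K} (hD : IsCompact (D : Set K))
    {x : K} (hx : x ∉ D) :
    ∃ U : Subgroup K, IsCompact (U : Set K) ∧ IsOpen (U : Set K) ∧ D ≤ U ∧ x ∉ U := by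
  obtain ⟨U, hUc, hUo, hDU, hU⟩ := exists_isCompact_isOpen_subgroup_subset hD
    (isOpen_compl_singleton (x := x)) fun d hd h => hx (h ▸ hd)
  exact ⟨U, hUc, hUo, hDU, fun h => hU h rfl⟩

end CompactOpen

section WordCore

variable {H K : Type*} [Group H] [Group K] {φ : H →* MulAut K} {S : Set H}

/-- The elements of `K` that every product of `n` elements of `S` maps into `U`. For a generating
set `S` containing `1`, these subgroups decrease to `invariantCore φ U`. -/
def wordCore (φ : H →* MulAut K) (S : Set H) (U : Subgroup K) (n : ℕ) : Subgroup K :=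
  ⨅ h ∈ S ^ n, U.comap (φ h).toMonoidHom

lemma mem_wordCore {U : Subgroup K} {n : ℕ} {x : K} :
    x ∈ wordCore φ S U n ↔ ∀ g ∈ S ^ n, φ g x ∈ U := by
  simp [wordCore, Subgroup.mem_iInf]

lemma mem_wordCore_one {U : Subgroup K} {x : K} :
    x ∈ wordCore φ S U 1 ↔ ∀ s ∈ S, φ s x ∈ U := by
  rw [mem_wordCore, pow_one]

lemma invariantCore_le_wordCore (U : Subgroup K) (n : ℕ) :
    invariantCore φ U ≤ wordCore φ S U n :=
  fun _ hx => mem_wordCore.2 fun g _ => mem_invariantCore.1 hx g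

lemma apply_mem_wordCore {U : Subgroup K} {m n : ℕ} {a : H} {x : K} (ha : a ∈ S ^ n)
    (hx : x ∈ wordCore φ S U (m + n)) : φ a x ∈ wordCore φ S U m := by
  refine mem_wordCore.2 fun g hg => ?_
  rw [← MulAut.mul_apply, ← map_mul]
  exact mem_wordCore.1 hx _ (pow_add S m n ▸ Set.mul_mem_mul hg ha)

variable [TopologicalSpace K]

lemma wordCore_antitone (hS : IsEquicontinuousGenerating φ S) (U : Subgroup K) :
    Antitone (wordCore φ S U) :=
  fun _ _ hmn _ hx => mem_wordCore.2 fun g hg =>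
    mem_wordCore.1 hx g (Set.pow_subset_pow_right hS.one_mem hmn hg)

lemma wordCore_le (hS : IsEquicontinuousGenerating φ S) (U : Subgroup K) (n : ℕ) :
    wordCore φ S U n ≤ U := fun x hx => by
  simpa using mem_wordCore.1 (wordCore_antitone hS U (Nat.zero_le n) hx) 1 (by simp)

lemma iInf_wordCore (hS : IsEquicontinuousGenerating φ S) (U : Subgroup K) :
    ⨅ n, wordCore φ S U n = invariantCore φ U := by
  refine le_antisymm (fun x hx => mem_invariantCore.2 fun h => ?_)
    (le_iInf (invariantCore_le_wordCore U))
  obtain ⟨n, hn⟩ := hS.exists_mem_pow h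
  exact mem_wordCore.1 (Subgroup.mem_iInf.1 hx n) h hn

lemma wordCore_le_invariantCore (hS : IsEquicontinuousGenerating φ S) {U : Subgroup K} {n : ℕ}
    (hn : wordCore φ S U n ≤ wordCore φ S U (n + 1)) :
    wordCore φ S U n ≤ invariantCore φ U :=
  le_invariantCore (hS.isInvariant fun s hs _ hx =>
    apply_mem_wordCore (by simpa using hs) (hn hx)) (wordCore_le hS U n)

/-- The elements of `K` that some product of `n` elements of `S` maps into `wordCore φ S U n`. An
element belonging to all these sets has an orbit accumulating at `invariantCore φ U`. -/
def wordReturn (φ : H →* MulAut K) (S : Set H) (U : Subgroup K) (n : ℕ) : Set K :=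
  {y | ∃ a ∈ S ^ n, φ a y ∈ wordCore φ S U n}

lemma wordReturn_antitone (hS : IsEquicontinuousGenerating φ S) (U : Subgroup K) :
    Antitone (wordReturn φ S U) := by
  refine antitone_nat_of_succ_le fun n y hy => ?_
  obtain ⟨_, ha, hay⟩ := hy
  obtain ⟨s, hs, b, hb, rfl⟩ := pow_succ' S n ▸ ha
  refine ⟨b, hb, ?_⟩
  have hsinv : s⁻¹ ∈ S ^ 1 := hS.inv_mem_pow (by simpa using hs)
  simpa using apply_mem_wordCore hsinv hay

variable [IsTopologicalGroup K]

lemma isOpen_wordCore (hS : IsEquicontinuousGenerating φ S) {U : Subgroup K}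
    (hU : IsOpen (U : Set K)) (n : ℕ) : IsOpen (wordCore φ S U n : Set K) :=
  Subgroup.isOpen_of_mem_nhds _ (g := 1) <|
    mem_of_superset (hS.pow_mem_nhds_one n (hU.mem_nhds U.one_mem)) fun _ hx => mem_wordCore.2 hx

lemma isClosed_wordCore (hS : IsEquicontinuousGenerating φ S) {U : Subgroup K}
    (hU : IsOpen (U : Set K)) (n : ℕ) : IsClosed (wordCore φ S U n : Set K) :=
  Subgroup.isClosed_of_isOpen _ (isOpen_wordCore hS hU n)

lemma isClosed_wordReturn (hS : IsEquicontinuousGenerating φ S) {U : Subgroup K}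
    (hU : IsOpen (U : Set K)) (n : ℕ) : IsClosed (wordReturn φ S U n) := by
  refine isClosed_of_closure_subset fun y hy => ?_
  obtain ⟨_, ⟨v, hv, rfl⟩, a, ha, hav⟩ := mem_closure_iff.1 hy
    (y • (wordCore φ S U (n + n) : Set K)) ((isOpen_wordCore hS hU _).smul y)
    ⟨1, Subgroup.one_mem _, by simp⟩
  refine ⟨a, ha, ?_⟩
  have hva : φ a v ∈ wordCore φ S U n := apply_mem_wordCore ha hv
  simpa using Subgroup.mul_mem _ hav (Subgroup.inv_mem _ hva)

lemma diff_inter_wordReturn_nonempty (hS : IsEquicontinuousGenerating φ S) {U : Subgroup K}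
    (hUo : IsOpen (U : Set K)) (hU : ¬ IsOpen (invariantCore φ U : Set K)) (n : ℕ) :
    (((U : Set K) \ wordCore φ S U 1) ∩ wordReturn φ S U n).Nonempty := by
  obtain ⟨x, hx, hx'⟩ : ∃ x ∈ wordCore φ S U n, x ∉ wordCore φ S U (n + 1) := by
    by_contra! hle
    exact hU (Subgroup.isOpen_mono (wordCore_le_invariantCore hS hle) (isOpen_wordCore hS hUo n))
  simp only [mem_wordCore, not_forall] at hx'
  obtain ⟨_, hg, hgx⟩ := hx'
  obtain ⟨s, hs, w, hw, rfl⟩ := pow_succ' S n ▸ hg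
  refine ⟨φ w x, ⟨mem_wordCore.1 hx w hw, fun hwx => hgx ?_⟩, w⁻¹, hS.inv_mem_pow hw, ?_⟩
  · simpa using mem_wordCore_one.1 hwx s hs
  · simpa using hx

-- By compactness some `y` outside the core belongs to every `wordReturn φ S U n`, so the closure of
-- its orbit meets every `wordCore φ S U n`.
lemma exists_notMem_invariantCore_closure_inter_nonempty [T2Space K]
    (hS : IsEquicontinuousGenerating φ S) {U : Subgroup K} (hUc : IsCompact (U : Set K))
    (hUo : IsOpen (U : Set K)) (hU : ¬ IsOpen (invariantCore φ U : Set K)) :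
    ∃ y ∉ invariantCore φ U,
      (closure (Set.range fun h => φ h y) ∩ (invariantCore φ U : Set K)).Nonempty := by
  have hK₀ : IsCompact ((U : Set K) \ wordCore φ S U 1) := hUc.diff (isOpen_wordCore hS hUo 1)
  obtain ⟨y, hy⟩ := IsCompact.nonempty_iInter_of_sequence_nonempty_isCompact_isClosed
    (fun n => ((U : Set K) \ wordCore φ S U 1) ∩ wordReturn φ S U n)
    (fun n => Set.inter_subset_inter_right _ (wordReturn_antitone hS U n.le_succ))
    (diff_inter_wordReturn_nonempty hS hUo hU)
    (hK₀.inter_right (isClosed_wordReturn hS hUo 0))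
    (fun n => hK₀.isClosed.inter (isClosed_wordReturn hS hUo n))
  simp only [Set.mem_iInter, Set.mem_inter_iff] at hy
  refine ⟨y, fun hcore => (hy 0).1.2 (invariantCore_le_wordCore U 1 hcore), ?_⟩
  rw [← iInf_wordCore hS, Subgroup.coe_iInf, Set.inter_iInter]
  refine IsCompact.nonempty_iInter_of_sequence_nonempty_isCompact_isClosed _
    (fun n => Set.inter_subset_inter_right _ (wordCore_antitone hS U n.le_succ)) (fun n => ?_)
    (hUc.of_isClosed_subset (isClosed_closure.inter (isClosed_wordCore hS hUo 0))
      (Set.inter_subset_right.trans (wordCore_le hS U 0)))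
    (fun n => isClosed_closure.inter (isClosed_wordCore hS hUo n))
  obtain ⟨a, -, ha⟩ := (hy n).2
  exact ⟨φ a y, subset_closure ⟨a, rfl⟩, ha⟩

end WordCore

section Ellis

variable (H X : Type*) [Monoid H] [MulAction H X] [TopologicalSpace X]

/-- Distality of an action on an arbitrary space; `IsDistalOn φ D` is the case of the coset space
`K ⧸ D`. -/
def IsDistalAction : Prop :=
  ∀ x y : X, (∃ z, (z, z) ∈ closure (Set.range fun h : H => (h • x, h • y))) → x = y

/-- The Ellis (enveloping) semigroup of an action: the pointwise limits of the maps `x ↦ h • x`. -/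
def ellisSemigroup : Set (X → X) :=
  closure (Set.range fun (h : H) (x : X) => h • x)

variable {H X}

lemma IsDistalAction.injective_of_mem_ellisSemigroup (hdist : IsDistalAction H X) {p : X → X}
    (hp : p ∈ ellisSemigroup H X) : Function.Injective p := by
  intro x y hxy
  refine hdist x y ⟨p x, ?_⟩
  have hcont : Continuous fun q : X → X => (q x, q y) := by fun_prop
  have hmem := map_mem_closure hcont hp (t := Set.range fun h : H => (h • x, h • y))
    (by rintro _ ⟨h, rfl⟩; exact ⟨h, rfl⟩)
  simpa only [← hxy] using hmem

variable [ContinuousConstSMul H X]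

lemma comp_mem_ellisSemigroup {p q : X → X} (hp : p ∈ ellisSemigroup H X)
    (hq : q ∈ ellisSemigroup H X) : p ∘ q ∈ ellisSemigroup H X := by
  have hsmul (h : H) : (fun x => h • q x) ∈ ellisSemigroup H X := by
    refine map_mem_closure (f := fun (r : X → X) x => h • r x) (by fun_prop) hq ?_
    rintro _ ⟨g, rfl⟩
    exact ⟨h * g, funext fun x => mul_smul h g x⟩
  refine closure_minimal (t := (fun r : X → X => r ∘ q) ⁻¹' ellisSemigroup H X) ?_
    (isClosed_closure.preimage (continuous_pi fun x => continuous_apply (q x))) hp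
  rintro _ ⟨h, rfl⟩
  exact hsmul h

variable [CompactSpace X] [T2Space X]

-- The left ideal of the semigroup generated by `p` contains an idempotent `q ∘ p`, which is the
-- identity by injectivity.
lemma IsDistalAction.surjective_of_mem_ellisSemigroup (hdist : IsDistalAction H X) {p : X → X}
    (hp : p ∈ ellisSemigroup H X) : Function.Surjective p := by
  let _ : TopologicalSpace (Function.End X) := inferInstanceAs (TopologicalSpace (X → X))
  have : T2Space (Function.End X) := inferInstanceAs (T2Space (X → X))
  have hcomp (r : Function.End X) : Continuous fun q : Function.End X => q * r :=
    continuous_pi fun x => continuous_apply (r x)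
  have hideal : IsCompact ((fun q : X → X => q ∘ p) '' ellisSemigroup H X) :=
    isClosed_closure.isCompact.image (hcomp p)
  obtain ⟨_, ⟨q, hq, rfl⟩, hidem⟩ := exists_idempotent_in_compact_subsemigroup hcomp
    ((fun q : X → X => q ∘ p) '' ellisSemigroup H X) ⟨_, p, hp, rfl⟩ hideal (by
      rintro _ ⟨a, ha, rfl⟩ _ ⟨b, hb, rfl⟩
      exact ⟨a ∘ p ∘ b, comp_mem_ellisSemigroup ha (comp_mem_ellisSemigroup hp hb), rfl⟩)
  have hqp (x : X) : q (p x) = x :=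
    hdist.injective_of_mem_ellisSemigroup (comp_mem_ellisSemigroup hq hp) (congrFun hidem x)
  exact fun x => ⟨q x, hdist.injective_of_mem_ellisSemigroup hq (hqp (q x))⟩

lemma IsDistalAction.exists_tendsto_smul (hdist : IsDistalAction H X) (F : Ultrafilter H) (z : X) :
    ∃ u : X, Tendsto (fun h : H => h • u) F (𝓝 z) := by
  let p : X → X := (F.map fun (h : H) (x : X) => h • x).lim
  have hlim : Tendsto (fun (h : H) (x : X) => h • x) F (𝓝 p) := Ultrafilter.le_nhds_lim _
  obtain ⟨u, rfl⟩ := hdist.surjective_of_mem_ellisSemigroup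
    (mem_closure_of_tendsto hlim (Eventually.of_forall fun h => ⟨h, rfl⟩)) z
  exact ⟨u, tendsto_pi_nhds.1 hlim u⟩

end Ellis

section CosetAction

variable {H K L : Type*} [Group H] [Group K] [Group L]

/-- The map `L ⧸ D' → K ⧸ D` induced by a homomorphism `f` that maps `D'` into `D`; the subgroups
need not be normal. -/
def cosetMap (f : L →* K) {D' : Subgroup L} {D : Subgroup K} (hD : D' ≤ D.comap f) :
    L ⧸ D' → K ⧸ D :=
  Quotient.map' f fun a b hab => by
    rw [QuotientGroup.leftRel_apply] at hab ⊢
    simpa using hD hab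

@[simp]
lemma cosetMap_mk (f : L →* K) {D' : Subgroup L} {D : Subgroup K} (hD : D' ≤ D.comap f) (x : L) :
    cosetMap f hD (x : L ⧸ D') = (f x : K ⧸ D) :=
  rfl

/-- The action of `H` on the coset space of an invariant subgroup. -/
abbrev cosetAction (φ : H →* MulAut K) (D : Subgroup K) (hD : IsInvariant φ (D : Set K)) :
    MulAction H (K ⧸ D) where
  smul h := cosetMap (φ h).toMonoidHom fun _ hx => hD.apply_mem h hx
  one_smul q := by
    obtain ⟨x, rfl⟩ := QuotientGroup.mk_surjective q
    exact congrArg ((↑) : K → K ⧸ D) (by simp : φ 1 x = x)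
  mul_smul g h q := by
    obtain ⟨x, rfl⟩ := QuotientGroup.mk_surjective q
    exact congrArg ((↑) : K → K ⧸ D) (by simp : φ (g * h) x = φ g (φ h x))

/-- The action of `H` on an invariant subgroup, with `smulOn` as its scalar multiplication. -/
abbrev actionOn (φ : H →* MulAut K) (L : Subgroup K) (hL : IsInvariant φ (L : Set K)) :
    MulDistribMulAction H L where
  toSMul := smulOn φ L hL
  one_smul x := Subtype.ext (by simp : φ 1 (x : K) = x)
  mul_smul g h x := Subtype.ext (by simp : φ (g * h) (x : K) = φ g (φ h x))
  smul_mul h x y := Subtype.ext (map_mul (φ h) (x : K) y)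
  smul_one h := Subtype.ext (map_one (φ h))

/-- The action of `H` on an invariant subgroup, as a homomorphism into its automorphism group. -/
def restrictAction (φ : H →* MulAut K) (L : Subgroup K) (hL : IsInvariant φ (L : Set K)) :
    H →* MulAut L :=
  letI := actionOn φ L hL
  MulDistribMulAction.toMulAut H L

variable [TopologicalSpace K] [TopologicalSpace L]

lemma continuous_cosetMap {f : L →* K} (hf : Continuous f) {D' : Subgroup L} {D : Subgroup K}
    (hD : D' ≤ D.comap f) : Continuous (cosetMap f hD) :=
  hf.quotient_map' _

lemma continuous_restrictAction {φ : H →* MulAut K} (hφ : ∀ h, Continuous (φ h)) {L : Subgroup K}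
    (hL : IsInvariant φ (L : Set K)) (h : H) : Continuous (restrictAction φ L hL h) :=
  ((hφ h).comp continuous_subtype_val).subtype_mk _

lemma IsProximal.map {φ : H →* MulAut K} {ψ : H →* MulAut L} {f : L →* K} (hf : Continuous f)
    (hfψ : ∀ h x, f (ψ h x) = φ h (f x)) {D' : Subgroup L} {D : Subgroup K} (hD : D' ≤ D.comap f)
    {x y : L} (hxy : IsProximal ψ D' x y) : IsProximal φ D (f x) (f y) := by
  obtain ⟨z, hz⟩ := hxy
  have hcont := continuous_cosetMap hf hD
  refine ⟨cosetMap f hD z, map_mem_closure (f := Prod.map _ _) (hcont.prodMap hcont) hz ?_⟩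
  rintro _ ⟨h, rfl⟩
  exact ⟨h, by simp [hfψ]⟩

lemma IsDistalOn.restrictAction {φ : H →* MulAut K} {D C : Subgroup K} (hdist : IsDistalOn φ D)
    (hC : IsInvariant φ (C : Set K)) : IsDistalOn (restrictAction φ C hC) (D.subgroupOf C) :=
  fun x y hxy => QuotientGroup.eq.2 <| Subgroup.mem_subgroupOf.2 <| QuotientGroup.eq.1 <|
    hdist (C.subtype x) (C.subtype y)
      (hxy.map (f := C.subtype) continuous_subtype_val (fun _ _ => rfl) le_rfl)

end CosetAction

section Distal

variable {H K : Type*} [Group H] [Group K] [TopologicalSpace K] [IsTopologicalGroup K]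
  {φ : H →* MulAut K} {S : Set H}

lemma IsDistalOn.exists_tendsto_mk [CompactSpace K] (hφ : ∀ h, Continuous (φ h)) {D : Subgroup K}
    (hDcl : IsClosed (D : Set K)) (hD : IsInvariant φ (D : Set K)) (hdist : IsDistalOn φ D)
    (F : Ultrafilter H) (z : K ⧸ D) :
    ∃ u : K, Tendsto (fun h => (φ h u : K ⧸ D)) F (𝓝 z) := by
  let _ := cosetAction φ D hD
  have : ContinuousConstSMul H (K ⧸ D) := ⟨fun h => continuous_cosetMap (hφ h) _⟩
  have : IsDistalAction H (K ⧸ D) := fun x y => by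
    obtain ⟨x, rfl⟩ := QuotientGroup.mk_surjective x
    obtain ⟨y, rfl⟩ := QuotientGroup.mk_surjective y
    exact hdist x y
  obtain ⟨u, hu⟩ := this.exists_tendsto_smul F z
  obtain ⟨u, rfl⟩ := QuotientGroup.mk_surjective u
  exact ⟨u, hu⟩

lemma mem_of_isDistalOn_of_mem_closure (hφ : ∀ h, Continuous (φ h)) {C D : Subgroup K}
    (hDcl : IsClosed (D : Set K)) (hD : IsInvariant φ (D : Set K)) (hdist : IsDistalOn φ D)
    (hC : IsCompact (C : Set K)) (hCinv : IsInvariant φ (C : Set K)) (hDC : D ≤ C) {y z : K}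
    (hz : z ∈ C) (hyz : z ∈ closure (Set.range fun h => φ h y)) : y ∈ C := by
  have : CompactSpace C := isCompact_iff_compactSpace.1 hC
  have : NeBot (comap (fun h => φ h y) (𝓝 z)) := comap_neBot_iff.2 fun t ht => by
    obtain ⟨_, hmem, h, rfl⟩ := mem_closure_iff_nhds.1 hyz t ht
    exact ⟨h, hmem⟩
  let F : Ultrafilter H := Ultrafilter.of (comap (fun h => φ h y) (𝓝 z))
  have hy : Tendsto (fun h => (φ h y : K ⧸ D)) F (𝓝 (z : K ⧸ D)) :=
    (QuotientGroup.continuous_mk.tendsto z).comp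
      (tendsto_comap.mono_left (Ultrafilter.of_le _))
  obtain ⟨u, hu⟩ := (hdist.restrictAction hCinv).exists_tendsto_mk
    (continuous_restrictAction hφ hCinv) (hDcl.preimage continuous_subtype_val)
    (isInvariant_iff.2 fun h x hx => hD.apply_mem h hx) F ((⟨z, hz⟩ : C) : C ⧸ D.subgroupOf C)
  have hu' : Tendsto (fun h => (φ h u : K ⧸ D)) F (𝓝 (z : K ⧸ D)) :=
    ((continuous_cosetMap (f := C.subtype) continuous_subtype_val le_rfl).tendsto _).comp hu
  have hyu : (y : K ⧸ D) = (u : K) := hdist y u ⟨z, mem_closure_of_tendsto (hy.prodMk_nhds hu')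
    (Eventually.of_forall fun h => ⟨h, rfl⟩)⟩
  simpa using C.mul_mem u.2 (C.inv_mem (hDC (QuotientGroup.eq.1 hyu)))

theorem isOpen_invariantCore_of_isDistalOn [T2Space K] (hS : IsEquicontinuousGenerating φ S)
    {D : Subgroup K} (hDc : IsCompact (D : Set K)) (hD : IsInvariant φ (D : Set K))
    (hdist : IsDistalOn φ D) {U : Subgroup K} (hUc : IsCompact (U : Set K))
    (hUo : IsOpen (U : Set K)) (hDU : D ≤ U) : IsOpen (invariantCore φ U : Set K) := by
  by_contra hU
  obtain ⟨y, hy, z, hyz, hz⟩ :=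
    exists_notMem_invariantCore_closure_inter_nonempty hS hUc hUo hU
  have hcore : IsCompact (invariantCore φ U : Set K) :=
    hUc.of_isClosed_subset (isClosed_invariantCore hS.continuous hUc.isClosed) (invariantCore_le U)
  exact hy (mem_of_isDistalOn_of_mem_closure hS.continuous hDc.isClosed hD hdist hcore
    (isInvariant_invariantCore U) (le_invariantCore hD hDU) hz hyz)

end Distal

section Residuals

variable {H K : Type*} [Group H] [Group K] [TopologicalSpace K] {φ : H →* MulAut K} {S : Set H}

lemma isInvariant_distalResidual : IsInvariant φ (distalResidual φ : Set K) :=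
  IsInvariant.sInf fun _ hD => hD.2.1

lemma isClosed_distalResidual : IsClosed (distalResidual φ : Set K) := by
  rw [distalResidual, Subgroup.coe_sInf]
  exact isClosed_biInter fun D hD => hD.1

lemma isInvariant_discreteResidual : IsInvariant φ (discreteResidual φ : Set K) :=
  IsInvariant.sInf fun _ hU => hU.2

lemma isDistalOn_distalResidual : IsDistalOn φ (distalResidual φ) :=
  fun x y hxy => QuotientGroup.eq.2 <| Subgroup.mem_sInf.2 fun _ hD => QuotientGroup.eq.1 <|
    hD.2.2 x y (hxy.map (f := MonoidHom.id K) continuous_id (fun _ _ => rfl) (sInf_le hD))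

lemma oneDistalResidual_le_distalResidual : oneDistalResidual φ ≤ distalResidual φ :=
  sInf_le_sInf fun _ hD => ⟨hD.1, hD.2.1, fun x hx => hD.2.2 x 1 hx⟩

variable [IsTopologicalGroup K]

lemma isDistalOn_of_isOpen {U : Subgroup K} (hU : IsOpen (U : Set K))
    (hUinv : IsInvariant φ (U : Set K)) : IsDistalOn φ U := by
  have := QuotientGroup.discreteTopology hU
  rintro x y ⟨z, hz⟩
  rw [closure_discrete] at hz
  obtain ⟨h, hh⟩ := hz
  obtain ⟨hx, hy⟩ := Prod.ext_iff.1 hh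
  have hxy := hUinv.apply_mem h⁻¹ (QuotientGroup.eq.1 (hx.trans hy.symm))
  exact QuotientGroup.eq.2 (by simpa using hxy)

lemma distalResidual_le_discreteResidual : distalResidual φ ≤ discreteResidual φ :=
  sInf_le_sInf fun U hU =>
    ⟨Subgroup.isClosed_of_isOpen U hU.1, hU.2, isDistalOn_of_isOpen hU.1 hU.2⟩

lemma exists_isOpen_isInvariant_disjoint {C : Set K} (hC : IsCompact C)
    (hdisj : Disjoint C (discreteResidual φ : Set K)) :
    ∃ O : Subgroup K, IsOpen (O : Set K) ∧ IsInvariant φ (O : Set K) ∧ Disjoint C (O : Set K) := by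
  let 𝒪 : Set (Subgroup K) := {O | IsOpen (O : Set K) ∧ IsInvariant φ (O : Set K)}
  have : Nonempty 𝒪 := ⟨⊤, isOpen_univ, isInvariant_univ⟩
  obtain ⟨⟨O, hO, hOinv⟩, hCO⟩ := hC.elim_directed_family_closed (fun O : 𝒪 => (O.1 : Set K))
    (fun O => Subgroup.isClosed_of_isOpen _ O.2.1)
    (by rwa [← Set.disjoint_iff_inter_eq_empty, ← Set.biInter_eq_iInter 𝒪 fun O _ => (O : Set K),
      ← Subgroup.coe_sInf])
    (fun O P => ⟨⟨O ⊓ P, O.2.1.inter P.2.1, O.2.2.inf P.2.2⟩, Set.inter_subset_left,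
      Set.inter_subset_right⟩)
  exact ⟨O, hO, hOinv, Set.disjoint_iff_inter_eq_empty.2 hCO⟩

-- Some open invariant `O` avoids the compact set of those `x ∈ U` that an element of `S` moves
-- out of `U`.
lemma exists_isOpen_isInvariant_le (hS : IsEquicontinuousGenerating φ S) {U : Subgroup K}
    (hUc : IsCompact (U : Set K)) (hUo : IsOpen (U : Set K))
    (hRU : IsInvariant φ ((discreteResidual φ ⊓ U : Subgroup K) : Set K)) :
    ∃ W : Subgroup K, IsOpen (W : Set K) ∧ IsInvariant φ (W : Set K) ∧ W ≤ U := by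
  obtain ⟨O, hO, hOinv, hdisj⟩ := exists_isOpen_isInvariant_disjoint (φ := φ)
    (hUc.diff (isOpen_wordCore hS hUo 1)) (Set.disjoint_left.2 fun x hx hxR =>
      hx.2 (mem_wordCore_one.2 fun s _ => (hRU.apply_mem s ⟨hxR, hx.1⟩).2))
  refine ⟨O ⊓ U, hO.inter hUo,
    hS.isInvariant fun s hs x hx => ⟨hOinv.apply_mem s hx.1, ?_⟩, inf_le_right⟩
  have hxcore : x ∈ wordCore φ S U 1 := by
    by_contra hxcore
    exact Set.disjoint_left.1 hdisj ⟨hx.2, hxcore⟩ hx.1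
  exact mem_wordCore_one.1 hxcore s hs

variable [LocallyCompactSpace K] [TotallyDisconnectedSpace K]

theorem discreteResidual_eq_distalResidual (hS : IsEquicontinuousGenerating φ S)
    (hc : IsCompact (distalResidual φ : Set K)) : discreteResidual φ = distalResidual φ := by
  refine le_antisymm (fun x hx => ?_) distalResidual_le_discreteResidual
  by_contra hxD
  obtain ⟨U, hUc, hUo, hDU, hxU⟩ := exists_isCompact_isOpen_subgroup_notMem hc hxD
  have hopen := isOpen_invariantCore_of_isDistalOn hS hc isInvariant_distalResidual
    isDistalOn_distalResidual hUc hUo hDU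
  exact hxU (invariantCore_le U (Subgroup.mem_sInf.1 hx _ ⟨hopen, isInvariant_invariantCore U⟩))

theorem exists_isCompact_isOpen_isInvariant_subset (hS : IsEquicontinuousGenerating φ S)
    (hc : IsCompact (discreteResidual φ : Set K)) {V : Set K} (hV : IsOpen V)
    (hRV : (discreteResidual φ : Set K) ⊆ V) :
    ∃ W : Subgroup K, IsCompact (W : Set K) ∧ IsOpen (W : Set K) ∧ IsInvariant φ (W : Set K) ∧
      (W : Set K) ⊆ V := by
  obtain ⟨U, hUc, hUo, hRU, hUV⟩ := exists_isCompact_isOpen_subgroup_subset hc hV hRV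
  obtain ⟨W, hWo, hWinv, hWU⟩ := exists_isOpen_isInvariant_le hS hUc hUo
    ((inf_eq_left.2 hRU).symm ▸ isInvariant_discreteResidual)
  exact ⟨W, hUc.of_isClosed_subset (Subgroup.isClosed_of_isOpen W hWo) hWU, hWo, hWinv,
    fun _ hx => hUV (hWU hx)⟩

theorem tfae_isCompact_residual (hS : IsEquicontinuousGenerating φ S) :
    List.TFAE
      [IsCompact (distalResidual φ : Set K),
       IsCompact (discreteResidual φ : Set K),
       ∃ U : Subgroup K, IsCompact (U : Set K) ∧ IsOpen (U : Set K) ∧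
         IsInvariant φ (U : Set K)] := by
  tfae_have 1 → 2 := fun hc => discreteResidual_eq_distalResidual hS hc ▸ hc
  tfae_have 2 → 3 := fun hc => by
    obtain ⟨U, hUc, hUo, hU, -⟩ :=
      exists_isCompact_isOpen_isInvariant_subset hS hc isOpen_univ (Set.subset_univ _)
    exact ⟨U, hUc, hUo, hU⟩
  tfae_have 3 → 1 := fun ⟨U, hUc, hUo, hU⟩ =>
    have hle : distalResidual φ ≤ U := distalResidual_le_discreteResidual.trans (sInf_le ⟨hUo, hU⟩)
    hUc.of_isClosed_subset isClosed_distalResidual hle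
  tfae_finish

lemma exists_isCompact_isOpen_inf_eq {P R : Subgroup K} (hR : IsCompact (R : Set K)) (hPR : P ≤ R)
    (hP : IsOpen (P.subgroupOf R : Set R)) :
    ∃ U : Subgroup K, IsCompact (U : Set K) ∧ IsOpen (U : Set K) ∧ R ⊓ U = P := by
  obtain ⟨V, hV, hVP⟩ := isOpen_induced_iff.1 hP
  have hmem (x : K) (hx : x ∈ R) : x ∈ V ↔ x ∈ P := Set.ext_iff.1 hVP ⟨x, hx⟩
  have hPcl : IsClosed (P : Set K) := by
    have himage := hR.isClosed.isClosedMap_subtype_val _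
      (Subgroup.isClosed_of_isOpen (P.subgroupOf R) hP)
    convert himage using 1
    ext x
    exact ⟨fun hx => ⟨⟨x, hPR hx⟩, hx, rfl⟩, by rintro ⟨y, hy, rfl⟩; exact hy⟩
  obtain ⟨U, hUc, hUo, hPU, hUV⟩ := exists_isCompact_isOpen_subgroup_subset
    (hR.of_isClosed_subset hPcl hPR) hV fun x hx => (hmem x (hPR hx)).2 hx
  exact ⟨U, hUc, hUo, le_antisymm (fun x hx => (hmem x hx.1).1 (hUV hx.2)) (le_inf hPR hPU)⟩

theorem discreteResidual_le_of_isOpen_subgroupOf (hS : IsEquicontinuousGenerating φ S)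
    (hc : IsCompact (discreteResidual φ : Set K)) {P : Subgroup K} (hPR : P ≤ discreteResidual φ)
    (hPo : IsOpen (P.subgroupOf (discreteResidual φ) : Set (discreteResidual φ)))
    (hP : IsInvariant φ (P : Set K)) : discreteResidual φ ≤ P := by
  obtain ⟨U, hUc, hUo, hRU⟩ := exists_isCompact_isOpen_inf_eq hc hPR hPo
  obtain ⟨W, hWo, hWinv, hWU⟩ := exists_isOpen_isInvariant_le hS hUc hUo (hRU.symm ▸ hP)
  have hle : discreteResidual φ ≤ W := sInf_le ⟨hWo, hWinv⟩
  exact hRU ▸ le_inf le_rfl (hle.trans hWU)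

end Residuals

section Transfinite

universe u v

variable {H : Type v} {K : Type u} [Group H] [Group K] [TopologicalSpace K]
  {φ : H →* MulAut K} {S : Set H}

lemma discreteResidualOn_top : discreteResidualOn φ ⊤ = discreteResidual φ := by
  have hopen (U : Subgroup K) :
      IsOpen (U.subgroupOf ⊤ : Set (⊤ : Subgroup K)) ↔ IsOpen (U : Set K) :=
    ⟨fun hU => hU.preimage (f := fun x : K => (⟨x, Subgroup.mem_top x⟩ : (⊤ : Subgroup K)))
      (by fun_prop), fun hU => hU.preimage continuous_subtype_val⟩
  simp only [discreteResidualOn, discreteResidual, le_top, hopen, true_and]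

lemma discreteResidualOn_le {L : Subgroup K} (hL : IsInvariant φ (L : Set K)) :
    discreteResidualOn φ L ≤ L :=
  sInf_le ⟨le_rfl, by simp, hL⟩

lemma discreteResidualOn_mono {L M : Subgroup K} (hL : IsInvariant φ (L : Set K)) (hLM : L ≤ M) :
    discreteResidualOn φ L ≤ discreteResidualOn φ M := by
  refine le_sInf fun U ⟨_, hUo, hU⟩ => ?_
  have hopen : IsOpen ((U ⊓ L).subgroupOf L : Set L) := by
    rw [Subgroup.inf_subgroupOf_right]
    exact hUo.preimage (continuous_inclusion hLM)
  have hle : discreteResidualOn φ L ≤ U ⊓ L := sInf_le ⟨inf_le_right, hopen, hU.inf hL⟩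
  exact hle.trans inf_le_left

@[simp]
lemma residualSeries_zero : residualSeries φ 0 = ⊤ :=
  Ordinal.limitRecOn_zero ..

lemma residualSeries_add_one (α : Ordinal.{u}) :
    residualSeries φ (α + 1) = discreteResidualOn φ (residualSeries φ α) :=
  Ordinal.limitRecOn_add_one ..

lemma residualSeries_of_isSuccLimit {α : Ordinal.{u}} (hα : Order.IsSuccLimit α) :
    residualSeries φ α = ⨅ (β : Ordinal.{u}) (_ : β < α), residualSeries φ β :=
  Ordinal.limitRecOn_limit _ _ _ _ hα

lemma residualSeries_one : residualSeries φ 1 = discreteResidual φ := by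
  rw [← zero_add (1 : Ordinal), residualSeries_add_one, residualSeries_zero,
    discreteResidualOn_top]

lemma le_residualSeries {R : Subgroup K} (hRinv : IsInvariant φ (R : Set K))
    (hR : discreteResidualOn φ R = R) (α : Ordinal.{u}) : R ≤ residualSeries φ α := by
  induction α using Ordinal.limitRecOn with
  | zero => simp
  | add_one α ih =>
    rw [residualSeries_add_one]
    exact hR.ge.trans (discreteResidualOn_mono hRinv ih)
  | limit α hα ih =>
    rw [residualSeries_of_isSuccLimit hα]
    exact le_iInf₂ ih

variable [IsTopologicalGroup K] [LocallyCompactSpace K] [TotallyDisconnectedSpace K]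

lemma discreteResidualOn_discreteResidual (hS : IsEquicontinuousGenerating φ S)
    (hc : IsCompact (discreteResidual φ : Set K)) :
    discreteResidualOn φ (discreteResidual φ) = discreteResidual φ :=
  le_antisymm (discreteResidualOn_le isInvariant_discreteResidual)
    (le_sInf fun _ hP => discreteResidual_le_of_isOpen_subgroupOf hS hc hP.1 hP.2.1 hP.2.2)

theorem discreteResidual_eq_residualInfty (hS : IsEquicontinuousGenerating φ S)
    (hc : IsCompact (discreteResidual φ : Set K)) : discreteResidual φ = residualInfty φ :=
  le_antisymm (le_iInf (le_residualSeries isInvariant_discreteResidual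
    (discreteResidualOn_discreteResidual hS hc))) ((iInf_le _ 1).trans residualSeries_one.le)

end Transfinite

section Tidy

variable {K : Type*} [Group K] {α : MulAut K} {U W : Subgroup K} {x : K}

lemma mem_smul_subgroup : x ∈ α • U ↔ α⁻¹ x ∈ U :=
  Subgroup.mem_pointwise_smul_iff_inv_smul_mem

lemma zpow_smul_subgroup_eq (hW : α • W = W) (n : ℤ) : α ^ n • W = W :=
  (MulAction.stabilizer (MulAut K) W).zpow_mem hW n

lemma zpow_apply_mem_plusPart {k : ℤ} :
    (α ^ k) x ∈ plusPart α U ↔ ∀ n ≤ k, (α ^ n) x ∈ U := by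
  have hmem (y : K) : y ∈ plusPart α U ↔ ∀ n : ℕ, (α ^ n)⁻¹ y ∈ U :=
    Subgroup.mem_iInf.trans (forall_congr' fun n => mem_smul_subgroup)
  simp only [hmem, ← zpow_natCast, ← zpow_neg, ← MulAut.mul_apply, ← zpow_add]
  refine ⟨fun hx n hn => ?_, fun hx n => hx _ (by lia)⟩
  simpa [Int.toNat_of_nonneg (sub_nonneg.2 hn)] using hx (k - n).toNat

lemma mem_plusPart : x ∈ plusPart α U ↔ ∀ n ≤ (0 : ℤ), (α ^ n) x ∈ U := by
  simpa using zpow_apply_mem_plusPart (α := α) (U := U) (x := x) (k := 0)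

lemma mem_minusPart : x ∈ minusPart α U ↔ ∀ n ≥ (0 : ℤ), (α ^ n) x ∈ U := by
  rw [minusPart, ← plusPart, mem_plusPart]
  simp only [inv_zpow', ge_iff_le]
  exact ⟨fun hx n hn => by simpa using hx (-n) (by lia), fun hx n hn => hx (-n) (by lia)⟩

lemma plusPart_le : plusPart α U ≤ U := fun x hx => by
  simpa using mem_plusPart.1 hx 0 le_rfl

lemma plusPart_le_smul : plusPart α U ≤ α • plusPart α U := fun x hx => by
  rw [mem_smul_subgroup, ← zpow_neg_one, zpow_apply_mem_plusPart]
  exact fun n hn => mem_plusPart.1 hx n (by lia)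

/-- The set `U₊₊` as a subgroup. -/
def plusPlusSubgroup (α : MulAut K) (U : Subgroup K) : Subgroup K where
  carrier := plusPlusPart α U
  one_mem' := ⟨0, fun n _ => by simp⟩
  mul_mem' := by
    rintro a b ⟨m, hm⟩ ⟨k, hk⟩
    refine ⟨min m k, fun n hn => ?_⟩
    rw [map_mul]
    exact U.mul_mem (hm n (hn.trans (min_le_left _ _))) (hk n (hn.trans (min_le_right _ _)))
  inv_mem' := by
    rintro a ⟨m, hm⟩
    exact ⟨m, fun n hn => by rw [map_inv]; exact U.inv_mem (hm n hn)⟩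

lemma mem_plusPlusSubgroup : x ∈ plusPlusSubgroup α U ↔ ∃ m : ℤ, (α ^ m) x ∈ plusPart α U := by
  simp only [zpow_apply_mem_plusPart]
  rfl

lemma plusPart_le_plusPlusSubgroup : plusPart α U ≤ plusPlusSubgroup α U :=
  fun x hx => mem_plusPlusSubgroup.2 ⟨0, by simpa using hx⟩

lemma smul_plusPlusSubgroup : α • plusPlusSubgroup α U = plusPlusSubgroup α U := by
  ext x
  simp only [mem_smul_subgroup, mem_plusPlusSubgroup, ← zpow_neg_one, ← MulAut.mul_apply,
    ← zpow_add]
  exact (Equiv.addRight (-1 : ℤ)).exists_congr_left.trans (by simp)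

-- `A` and `α • A` are commensurate to `W` with the same indices, so the inclusion is an equality.
lemma smul_eq_of_le_of_relIndex_ne_zero {A : Subgroup K} (hW : α • W = W) (hA : A ≤ α • A)
    (hAW : A.relIndex W ≠ 0) (hWA : W.relIndex A ≠ 0) : α • A = A := by
  have hBW : (α • A).relIndex W = A.relIndex W := by
    conv_lhs => rw [← hW]
    exact Subgroup.relIndex_pointwise_smul α A W
  have hWB : W.relIndex (α • A) = W.relIndex A := by
    conv_lhs => rw [← hW]
    exact Subgroup.relIndex_pointwise_smul α W A
  have hinf : W ⊓ α • A = W ⊓ A := by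
    have hmul := Subgroup.relIndex_mul_relIndex (A ⊓ W) (α • A ⊓ W) W
      (inf_le_inf_right W hA) inf_le_right
    rw [Subgroup.inf_relIndex_right, Subgroup.inf_relIndex_right, hBW] at hmul
    rw [inf_comm, inf_comm W]
    exact le_antisymm (Subgroup.relIndex_eq_one.1 ((mul_eq_right₀ hAW).1 hmul))
      (inf_le_inf_right W hA)
  have hmul := Subgroup.relIndex_mul_relIndex (W ⊓ A) A (α • A) inf_le_right hA
  rw [← hinf, Subgroup.inf_relIndex_right, hinf, Subgroup.inf_relIndex_right, hWB] at hmul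
  exact le_antisymm (Subgroup.relIndex_eq_one.1 ((mul_eq_left₀ hWA).1 hmul)) hA

variable [TopologicalSpace K]

lemma isClosed_plusPart (hα : ∀ n : ℤ, Continuous (α ^ n : MulAut K)) (hU : IsClosed (U : Set K)) :
    IsClosed (plusPart α U : Set K) := by
  have hplus : (plusPart α U : Set K) = ⋂ n ≤ (0 : ℤ), (α ^ n : MulAut K) ⁻¹' U := by
    ext x
    simp [mem_plusPart]
  rw [hplus]
  exact isClosed_biInter fun n _ => hU.preimage (hα n)

variable [IsTopologicalGroup K]

lemma exists_isOpen_of_iUnion_eq_univ [BaireSpace K] {ι : Type*} [Countable ι]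
    {A : ι → Subgroup K} (hA : ∀ i, IsClosed (A i : Set K))
    (hcover : ⋃ i, (A i : Set K) = Set.univ) :
    ∃ i, IsOpen (A i : Set K) := by
  obtain ⟨i, x, hx⟩ := nonempty_interior_of_iUnion_of_closed hA hcover
  exact ⟨i, Subgroup.isOpen_of_mem_nhds (A i) (mem_interior_iff_mem_nhds.1 hx)⟩

lemma relIndex_ne_zero_of_isOpen_subgroupOf {A U : Subgroup K} (hU : IsCompact (U : Set K))
    (hA : IsOpen (A.subgroupOf U : Set U)) : A.relIndex U ≠ 0 := by
  have : CompactSpace U := isCompact_iff_compactSpace.1 hU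
  have := Subgroup.quotient_finite_of_isOpen (A.subgroupOf U) hA
  exact (Subgroup.finiteIndex_of_finite_quotient (H := A.subgroupOf U)).index_ne_zero

lemma relIndex_ne_zero_of_isCompact_of_isOpen {A U : Subgroup K} (hU : IsCompact (U : Set K))
    (hA : IsOpen (A : Set K)) : A.relIndex U ≠ 0 :=
  relIndex_ne_zero_of_isOpen_subgroupOf hU (hA.preimage continuous_subtype_val)

-- `X` is the union of the closed subgroups `αⁿ(U₊) ∩ X`, one of which is open by Baire's theorem.
lemma relIndex_plusPart_ne_zero (hα : ∀ n : ℤ, Continuous (α ^ n : MulAut K))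
    (hU : IsClosed (U : Set K)) {X : Subgroup K} (hXc : IsCompact (X : Set K)) (hX : α • X = X)
    (hXU : X ≤ plusPlusSubgroup α U) : (plusPart α U).relIndex X ≠ 0 := by
  have : CompactSpace X := isCompact_iff_compactSpace.1 hXc
  let A : ℤ → Subgroup X := fun n => (α ^ n • plusPart α U).subgroupOf X
  have hA (n : ℤ) : (A n : Set X) = (fun x : X => (α ^ (-n)) (x : K)) ⁻¹' plusPart α U := by
    ext x
    simp [A, Subgroup.mem_subgroupOf, mem_smul_subgroup, zpow_neg]
  obtain ⟨n, hn⟩ := exists_isOpen_of_iUnion_eq_univ (A := A)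
    (fun n => hA n ▸ (isClosed_plusPart hα hU).preimage ((hα _).comp continuous_subtype_val))
    (Set.eq_univ_of_forall fun x => by
      obtain ⟨m, hm⟩ := mem_plusPlusSubgroup.1 (hXU x.2)
      exact Set.mem_iUnion.2 ⟨-m, by rw [hA]; simpa using hm⟩)
  have hindex := relIndex_ne_zero_of_isOpen_subgroupOf hXc hn
  rwa [← zpow_smul_subgroup_eq hX n, Subgroup.relIndex_pointwise_smul] at hindex

variable [T2Space K]

lemma IsTidy.smul_plusPart_eq (hα : ∀ n : ℤ, Continuous (α ^ n : MulAut K)) (hU : IsTidy α U)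
    (hWc : IsCompact (W : Set K)) (hWo : IsOpen (W : Set K)) (hW : α • W = W) :
    α • plusPart α U = plusPart α U := by
  let X := W ⊓ plusPlusSubgroup α U
  have hX : α • X = X := by rw [Subgroup.smul_inf, hW, smul_plusPlusSubgroup]
  have hXc : IsCompact (X : Set K) := hWc.inter_right hU.tidyBelow
  have hX_plus : X.relIndex (plusPart α U) ≠ 0 := by
    rw [← Subgroup.inf_relIndex_right, inf_assoc, inf_eq_right.2 plusPart_le_plusPlusSubgroup,
      Subgroup.inf_relIndex_right]
    exact mt (Subgroup.relIndex_eq_zero_of_le_right plusPart_le)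
      (relIndex_ne_zero_of_isCompact_of_isOpen hU.isCompact hWo)
  exact smul_eq_of_le_of_relIndex_ne_zero hX plusPart_le_smul
    (relIndex_plusPart_ne_zero hα hU.isCompact.isClosed hXc hX inf_le_right) hX_plus

theorem IsTidy.smul_eq (hα : ∀ n : ℤ, Continuous (α ^ n : MulAut K)) (hU : IsTidy α U)
    (hWc : IsCompact (W : Set K)) (hWo : IsOpen (W : Set K)) (hW : α • W = W) : α • U = U := by
  have hplus_le_minus : plusPart α U ≤ minusPart α U := fun x hx => mem_minusPart.2 fun n _ => by
    refine plusPart_le (α := α) ?_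
    rw [← zpow_smul_subgroup_eq (hU.smul_plusPart_eq hα hWc hWo hW) n]
    exact Subgroup.smul_mem_pointwise_smul x (α ^ n) _ hx
  have hU_eq : U = minusPart α U := by
    refine SetLike.coe_injective (hU.tidyAbove.trans (Set.Subset.antisymm ?_ ?_))
    · rintro _ ⟨a, ha, b, hb, rfl⟩
      exact (minusPart α U).mul_mem (hplus_le_minus ha) hb
    · exact fun b hb => ⟨1, one_mem _, b, hb, one_mul b⟩
  have hUinv : U ≤ α⁻¹ • U := fun x hx => by
    rw [mem_smul_subgroup, inv_inv]
    rw [hU_eq] at hx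
    simpa using mem_minusPart.1 hx 1 zero_le_one
  have hinv : α⁻¹ • U = U := smul_eq_of_le_of_relIndex_ne_zero (inv_smul_eq_iff.2 hW.symm) hUinv
    (relIndex_ne_zero_of_isCompact_of_isOpen hWc hU.isOpen)
    (relIndex_ne_zero_of_isCompact_of_isOpen hU.isCompact hWo)
  exact (inv_smul_eq_iff.1 hinv).symm

end Tidy

section Nub

variable {H K : Type*} [Group H] [Group K] [TopologicalSpace K] [IsTopologicalGroup K]
  {φ : H →* MulAut K} {S : Set H}

lemma isTidyFor_of_isInvariant {U : Subgroup K} (hUc : IsCompact (U : Set K))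
    (hUo : IsOpen (U : Set K)) (hU : IsInvariant φ (U : Set K)) : IsTidyFor φ U := by
  intro h
  have hmem (n : ℤ) (x : K) : (φ h ^ n) x ∈ U ↔ x ∈ U := by
    rw [← map_zpow]
    refine ⟨fun hx => ?_, fun hx => hU.apply_mem _ hx⟩
    simpa using hU.apply_mem (h ^ n)⁻¹ hx
  have hplus : plusPart (φ h) U = U := by
    ext x
    simpa only [mem_plusPart, hmem] using ⟨fun hx => hx 0 le_rfl, fun hx _ _ => hx⟩
  have hminus : minusPart (φ h) U = U := by
    ext x
    simpa only [mem_minusPart, hmem] using ⟨fun hx => hx 0 le_rfl, fun hx _ _ => hx⟩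
  have hplusPlus : plusPlusPart (φ h) U = U := by
    ext x
    simp only [plusPlusPart, hmem]
    exact ⟨fun ⟨m, hm⟩ => hm m le_rfl, fun hx => ⟨0, fun _ _ => hx⟩⟩
  refine ⟨hUc, hUo, ?_, ?_⟩
  · rw [hplus, hminus, coe_mul_coe]
  · rw [hplusPlus]
    exact Subgroup.isClosed_of_isOpen U hUo

lemma IsTidyFor.isInvariant [T2Space K] (hφ : ∀ h, Continuous (φ h)) {U W : Subgroup K}
    (hU : IsTidyFor φ U) (hWc : IsCompact (W : Set K)) (hWo : IsOpen (W : Set K))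
    (hW : IsInvariant φ (W : Set K)) : IsInvariant φ (U : Set K) := fun h =>
  congrArg ((↑) : Subgroup K → Set K) <|
    (hU h).smul_eq (fun n => map_zpow φ h n ▸ hφ _) hWc hWo (hW.map_eq h)

theorem nub_eq_discreteResidual [LocallyCompactSpace K] [TotallyDisconnectedSpace K]
    (hS : IsEquicontinuousGenerating φ S) (hc : IsCompact (discreteResidual φ : Set K)) :
    nub φ = discreteResidual φ := by
  refine le_antisymm (fun x hx => ?_) (le_sInf fun U hU => ?_)
  · by_contra hxR
    obtain ⟨U, hUc, hUo, hUinv, hUx⟩ := exists_isCompact_isOpen_isInvariant_subset hS hc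
      (isOpen_compl_singleton (x := x)) fun r hr h => hxR (h ▸ hr)
    exact hUx (Subgroup.mem_sInf.1 hx U (isTidyFor_of_isInvariant hUc hUo hUinv)) rfl
  · obtain ⟨W, hWc, hWo, hW, -⟩ :=
      exists_isCompact_isOpen_isInvariant_subset hS hc isOpen_univ (Set.subset_univ _)
    exact sInf_le ⟨(hU 1).isOpen, hU.isInvariant hS.continuous hWc hWo hW⟩

end Nub

section Ergodicity

open scoped symmDiff

lemma continuous_measure_smul_symmDiff {G X : Type*} [Group G] [TopologicalSpace G]
    [ContinuousInv G] [TopologicalSpace X] [R1Space X] [MeasurableSpace X] [BorelSpace X]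
    [MulAction G X] [ContinuousSMul G X] (μ : Measure X) [IsFiniteMeasure μ]
    [μ.InnerRegularCompactLTTop] [SMulInvariantMeasure G X μ] {A : Set X} (hA : MeasurableSet A) :
    Continuous fun g : G => μ ((g • A) ∆ A) := by
  let f : C(G, C(X, X)) := (ContinuousMap.mk fun q : G × X => q.1⁻¹ • q.2).curry
  have hf (g : G) : g • A = f g ⁻¹' A := (Set.preimage_smul_inv g A).symm
  have hmp (g : G) : MeasurePreserving (f g) μ μ := measurePreserving_smul g⁻¹ μ
  let F : G → MeasuredSets μ := fun g => ⟨g • A, hf g ▸ (hmp g).measurable hA⟩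
  have hF : Continuous F := continuous_iff_continuousAt.2 fun g => by
    rw [ContinuousAt, tendsto_iff_edist_tendsto_0]
    simp only [MeasuredSets.edist_def]
    change Tendsto (fun g' => μ ((g' • A) ∆ (g • A))) (𝓝 g) (𝓝 0)
    simp only [hf]
    exact tendsto_measure_symmDiff_preimage_nhds_zero (f.continuous.tendsto g)
      (Eventually.of_forall hmp) (hmp g) hA.nullMeasurableSet (measure_ne_top μ A)
  exact hF.edist (continuous_const (y := show MeasuredSets μ from ⟨A, hA⟩))

lemma measure_apply_smul_symmDiff {R : Type*} [Group R] [MeasurableSpace R] [MeasurableMul R]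
    {μ : Measure R} [μ.IsMulLeftInvariant] {α : MulAut R} (hα : MeasurePreserving α μ μ) {A : Set R}
    (hA : MeasurableSet A) (hαA : α ⁻¹' A =ᵐ[μ] A) (r : R) :
    μ ((α r • A) ∆ A) = μ ((r • A) ∆ A) := by
  have hpreimage : α ⁻¹' (α r • A) = r • (α ⁻¹' A) := by
    ext x
    simp only [Set.mem_preimage, Set.mem_smul_set_iff_inv_smul_mem, smul_eq_mul, map_mul, map_inv]
  have hmeas : MeasurableSet ((α r • A) ∆ A) := (hA.const_smul _).symmDiff hA
  calc μ ((α r • A) ∆ A) = μ (α ⁻¹' ((α r • A) ∆ A)) :=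
        (hα.measure_preimage hmeas.nullMeasurableSet).symm
    _ = μ ((r • (α ⁻¹' A)) ∆ (α ⁻¹' A)) := by rw [Set.preimage_symmDiff, hpreimage]
    _ = μ ((r • A) ∆ A) := measure_congr (((smul_set_ae_eq r).2 hαA).symmDiff hαA)

variable {H R : Type*} [Group H] [Group R] [TopologicalSpace R] [IsTopologicalGroup R]
  [CompactSpace R] {ψ : H →* MulAut R}

-- For an open subgroup `U ≥ Z`, the fibres of `f` outside `f '' Uᶜ` form an invariant open
-- neighbourhood of `1` in `U`.
lemma eq_top_of_discreteResidual_eq_top [TotallyDisconnectedSpace R]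
    (hR : discreteResidual ψ = ⊤) {Y : Type*} [TopologicalSpace Y] [T2Space Y] {f : R → Y}
    (hf : Continuous f) (hfψ : ∀ h r, f (ψ h r) = f r) {y : Y} {Z : Subgroup R}
    (hZ : ∀ r, f r = y ↔ r ∈ Z) : Z = ⊤ := by
  have hZ_eq : (Z : Set R) = f ⁻¹' {y} := Set.ext fun r => (hZ r).symm
  have hZcl : IsClosed (Z : Set R) := hZ_eq ▸ isClosed_singleton.preimage hf
  refine (Subgroup.eq_top_iff' Z).2 fun r => ?_
  by_contra hr
  obtain ⟨U, -, hUo, hZU, hrU⟩ := exists_isCompact_isOpen_subgroup_notMem hZcl.isCompact hr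
  let V : Set R := f ⁻¹' (f '' (U : Set R)ᶜ)ᶜ
  have hVo : IsOpen V := (hUo.isClosed_compl.isCompact.image hf).isClosed.isOpen_compl.preimage hf
  have hVU : V ⊆ U := fun x hx => by
    by_contra hxU
    exact hx ⟨x, hxU, rfl⟩
  have hVcore : V ⊆ invariantCore ψ U := fun x hx => mem_invariantCore.2 fun h =>
    hVU (by simpa only [V, Set.mem_preimage, hfψ] using hx)
  have hV1 : (1 : R) ∈ V := by
    rintro ⟨x, hxU, hx⟩
    exact hxU (hZU ((hZ x).1 (hx.trans ((hZ 1).2 Z.one_mem))))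
  have hcore : IsOpen (invariantCore ψ U : Set R) :=
    Subgroup.isOpen_of_mem_nhds _ (mem_of_superset (hVo.mem_nhds hV1) hVcore)
  have hle : discreteResidual ψ ≤ invariantCore ψ U :=
    sInf_le ⟨hcore, isInvariant_invariantCore U⟩
  exact hrU (invariantCore_le U (hle (hR ▸ Subgroup.mem_top r)))

variable [MeasurableSpace R] [BorelSpace R] (μ : Measure R) [μ.IsHaarMeasure]

-- If `A` is almost invariant then `μ.restrict A` is left invariant, hence a multiple of `μ`.
lemma ergodicSMul_self : ErgodicSMul R R μ := by
  refine ⟨fun {A} hA hinv => ?_⟩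
  have : (μ.restrict A).IsMulLeftInvariant := ⟨fun r => by
    ext s hs
    rw [Measure.map_apply (measurable_const_mul r) hs, Measure.restrict_apply hs,
      Measure.restrict_apply (hs.preimage (measurable_const_mul r)),
      ← measure_preimage_mul μ r (s ∩ A), Set.preimage_inter]
    exact measure_congr ((ae_eq_refl _).inter (hinv r).symm)⟩
  have hrestrict := Measure.isMulInvariant_eq_smul_of_compactSpace (μ.restrict A) μ
  set c := Measure.haarScalarFactor (μ.restrict A) μ
  have hcompl : c • μ Aᶜ = 0 := by
    simpa [hA] using (congrArg (fun ν : Measure R => ν Aᶜ) hrestrict).symm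
  rw [eventuallyConst_set', ae_eq_empty, ae_eq_univ]
  rcases eq_or_ne c 0 with hc | hc
  · exact .inl (by rwa [hc, zero_smul, Measure.restrict_eq_zero] at hrestrict)
  · exact .inr (by simpa [ENNReal.smul_def, hc] using hcompl)

variable {μ}

theorem eventuallyConst_of_forall_preimage_ae_eq [TotallyDisconnectedSpace R]
    (hψ : ∀ h, MeasurePreserving (ψ h) μ μ) (hR : discreteResidual ψ = ⊤) {A : Set R}
    (hA : MeasurableSet A) (hψA : ∀ h, ψ h ⁻¹' A =ᵐ[μ] A) : EventuallyConst A (ae μ) := by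
  have := ergodicSMul_self μ
  refine MulAction.aeconst_of_aestabilizer_eq_top R hA.nullMeasurableSet ?_
  exact eq_top_of_discreteResidual_eq_top hR (continuous_measure_smul_symmDiff μ hA)
    (fun h => measure_apply_smul_symmDiff (hψ h) hA (hψA h))
    fun r => measure_symmDiff_eq_zero_iff

end Ergodicity

section ErgodicOn

variable {H K : Type*} [Group H] [Group K] [TopologicalSpace K] {φ : H →* MulAut K}
  {L : Subgroup K}

lemma discreteResidual_restrictAction_eq_top (hL : IsInvariant φ (L : Set K))
    (hres : discreteResidualOn φ L = L) : discreteResidual (restrictAction φ L hL) = ⊤ := by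
  refine sInf_eq_top.2 fun P ⟨hPo, hP⟩ => ?_
  have hPL : (P.map L.subtype).subgroupOf L = P :=
    Subgroup.comap_map_eq_self_of_injective L.subtype_injective P
  have hinv : IsInvariant φ (P.map L.subtype : Set K) := isInvariant_iff.2 <| by
    rintro h _ ⟨x, hx, rfl⟩
    exact ⟨_, hP.apply_mem h hx, rfl⟩
  have hle : discreteResidualOn φ L ≤ P.map L.subtype :=
    sInf_le ⟨Subgroup.map_subtype_le P, hPL.symm ▸ hPo, hinv⟩
  rw [← hPL]
  exact Subgroup.subgroupOf_eq_top.2 (hres.ge.trans hle)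

lemma isProximal_one_of_mem_closure {D : Subgroup K} {x : K}
    (hx : (1 : K) ∈ closure (Set.range fun h => φ h x)) : IsProximal φ D x 1 := by
  refine ⟨((1 : K) : K ⧸ D), map_mem_closure
    (f := fun y : K => ((y : K ⧸ D), ((1 : K) : K ⧸ D))) (by fun_prop) hx ?_⟩
  rintro _ ⟨h, rfl⟩
  exact ⟨h, by simp⟩

variable [IsTopologicalGroup K]

theorem isErgodicOn_of_discreteResidualOn_eq [TotallyDisconnectedSpace K]
    (hφ : ∀ h, Continuous (φ h)) (hLc : IsCompact (L : Set K)) (hL : IsInvariant φ (L : Set K))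
    (hres : discreteResidualOn φ L = L) : IsErgodicOn φ L := by
  refine ⟨hL, fun {_} _ μ _ _ => ?_⟩
  have : CompactSpace L := isCompact_iff_compactSpace.1 hLc
  let ψ := restrictAction φ L hL
  have hψ (h : H) : MeasurePreserving (ψ h) μ μ :=
    (ψ h).toMonoidHom.measurePreserving (continuous_restrictAction hφ hL h) (ψ h).surjective rfl
  let _ := smulOn φ L hL
  have : SMulInvariantMeasure H L μ :=
    ⟨fun h _ hs => (hψ h).measure_preimage hs.nullMeasurableSet⟩
  exact ⟨fun hA hinv => eventuallyConst_of_forall_preimage_ae_eq hψ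
    (discreteResidual_restrictAction_eq_top hL hres) hA hinv⟩

lemma ae_exists_smul_mem {X : Type*} [TopologicalSpace X] [MeasurableSpace X]
    [OpensMeasurableSpace X] [MulAction H X] [ContinuousConstSMul H X] {μ : Measure X}
    [μ.IsOpenPosMeasure] [ErgodicSMul H X μ] {O : Set X} (hO : IsOpen O) (hne : O.Nonempty) :
    ∀ᵐ x ∂μ, ∃ h : H, h • x ∈ O := by
  let A : Set X := ⋃ h : H, (h • ·) ⁻¹' O
  have hAo : IsOpen A := isOpen_iUnion fun h => hO.preimage (continuous_const_smul h)
  have hOA : O ⊆ A := fun x hx => Set.mem_iUnion.2 ⟨1, by simpa using hx⟩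
  have hAinv (g : H) : (g • ·) ⁻¹' A = A := by
    ext x
    simp only [A, Set.mem_preimage, Set.mem_iUnion, ← mul_smul]
    exact (Equiv.mulRight g).exists_congr_left.trans (by simp)
  rcases eventuallyConst_set.1 (aeconst_of_forall_preimage_smul_ae_eq (μ := μ) H
    hAo.measurableSet.nullMeasurableSet fun g => EventuallyEq.of_eq (hAinv g)) with hA | hA
  · filter_upwards [hA] with x hx using Set.mem_iUnion.1 hx
  · have hA0 : μ A = 0 := measure_eq_zero_iff_ae_notMem.2 hA
    exact absurd (measure_mono_null hOA hA0) (hO.measure_ne_zero μ hne)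

lemma ae_dense_orbit {X : Type*} [TopologicalSpace X] [SecondCountableTopology X]
    [MeasurableSpace X] [OpensMeasurableSpace X] [MulAction H X] [ContinuousConstSMul H X]
    {μ : Measure X} [μ.IsOpenPosMeasure] [ErgodicSMul H X μ] :
    ∀ᵐ x ∂μ, Dense (MulAction.orbit H x) := by
  have hbasis := TopologicalSpace.isBasis_countableBasis X
  have hmeet : ∀ᵐ x ∂μ, ∀ O ∈ TopologicalSpace.countableBasis X, ∃ h : H, h • x ∈ O :=
    (ae_ball_iff (TopologicalSpace.countable_countableBasis X)).2 fun O hO =>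
      ae_exists_smul_mem (hbasis.isOpen hO) (TopologicalSpace.nonempty_of_mem_countableBasis hO)
  filter_upwards [hmeet] with x hx
  refine hbasis.dense_iff.2 fun O hO _ => ?_
  obtain ⟨h, hh⟩ := hx O hO
  exact ⟨h • x, hh, MulAction.mem_orbit x h⟩

theorem IsErgodicOn.le_of_isDistalAtOneOn (hφ : ∀ h, Continuous (φ h)) {D : Subgroup K}
    (hLc : IsCompact (L : Set K)) [TopologicalSpace.MetrizableSpace L] (hL : IsErgodicOn φ L)
    (hD : IsClosed (D : Set K)) (hdist : IsDistalAtOneOn φ D) : L ≤ D := by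
  obtain ⟨hLinv, herg⟩ := hL
  have : CompactSpace L := isCompact_iff_compactSpace.1 hLc
  let _ : MeasurableSpace L := borel L
  have : BorelSpace L := ⟨rfl⟩
  let _ := actionOn φ L hLinv
  have : ContinuousConstSMul H L := ⟨continuous_restrictAction hφ hLinv⟩
  have : ErgodicSMul H L (Measure.haar : Measure L) := herg _
  have hae : ∀ᵐ x : L ∂Measure.haar, (x : K) ∈ D := by
    filter_upwards [ae_dense_orbit (H := H)] with x hx
    have hclosure : (1 : K) ∈ closure (Set.range fun h => φ h x) :=
      map_mem_closure (f := ((↑) : L → K)) continuous_subtype_val (hx 1) (by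
        rintro _ ⟨h, rfl⟩
        exact ⟨h, rfl⟩)
    simpa using QuotientGroup.eq.1 (hdist x (isProximal_one_of_mem_closure hclosure))
  have hdense : Dense {x : L | (x : K) ∈ D} := Measure.dense_of_ae hae
  have huniv := (hD.preimage continuous_subtype_val).closure_eq.symm.trans hdense.closure_eq
  exact fun x hx => huniv.ge (Set.mem_univ (⟨x, hx⟩ : L))

end ErgodicOn

section Conjugation

variable {G : Type*} [Group G] [TopologicalSpace G] [IsTopologicalGroup G] {H K : Subgroup G}

lemma continuous_conjAction (hHK : H ≤ Subgroup.normalizer (K : Set G)) :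
    Continuous fun q : H × K => conjAction H K hHK q.1 q.2 :=
  Continuous.subtype_mk (f := fun q : H × K => (q.1 : G) * q.2 * (q.1 : G)⁻¹) (by fun_prop) _

end Conjugation

end TDLC

theorem mainTheorem5_general {H K : Type*} [Group H] [TopologicalSpace H] [IsTopologicalGroup H]
    [Group K] [TopologicalSpace K] [IsTopologicalGroup K] [LocallyCompactSpace K]
    [TotallyDisconnectedSpace K] (φ : H →* MulAut K)
    (hφ : Continuous fun q : H × K => φ q.1 q.2) (N : Subgroup H) [N.Normal]
    (hSIN : TDLC.HasSIN (φ.comp N.subtype)) (hcg : TDLC.IsCompactlyGenerated (H ⧸ N)) :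
    List.TFAE
      [IsCompact (TDLC.distalResidual φ : Set K),
       IsCompact (TDLC.discreteResidual φ : Set K),
       ∃ U : Subgroup K, IsCompact (U : Set K) ∧ IsOpen (U : Set K) ∧
         TDLC.IsInvariant φ (U : Set K)] ∧
    ((IsCompact (TDLC.distalResidual φ : Set K) ∨
      IsCompact (TDLC.discreteResidual φ : Set K) ∨
      ∃ U : Subgroup K, IsCompact (U : Set K) ∧ IsOpen (U : Set K) ∧
         TDLC.IsInvariant φ (U : Set K)) →
      TDLC.IsFlat φ ∧
      TDLC.nub φ = TDLC.discreteResidual φ ∧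
      TDLC.discreteResidual φ = TDLC.residualInfty φ ∧
      TDLC.residualInfty φ = TDLC.distalResidual φ ∧
      TDLC.IsErgodicOn φ (TDLC.nub φ) ∧
      (TopologicalSpace.MetrizableSpace (TDLC.nub φ) →
        TDLC.nub φ = TDLC.oneDistalResidual φ)) := by
  obtain ⟨S, hS⟩ := TDLC.exists_isEquicontinuousGenerating hφ N hSIN hcg
  have htfae := TDLC.tfae_isCompact_residual hS
  refine ⟨htfae, fun hany => ?_⟩
  have hdist : IsCompact (TDLC.distalResidual φ : Set K) :=
    hany.elim id fun h => h.elim (htfae.out 0 1).2 (htfae.out 0 2).2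
  have hres : IsCompact (TDLC.discreteResidual φ : Set K) := (htfae.out 0 1).1 hdist
  obtain ⟨U, hUc, hUo, hU⟩ := (htfae.out 0 2).1 hdist
  have hflat : TDLC.IsFlat φ := ⟨U, TDLC.isTidyFor_of_isInvariant hUc hUo hU⟩
  have hnub := TDLC.nub_eq_discreteResidual hS hres
  have hinfty := TDLC.discreteResidual_eq_residualInfty hS hres
  have heq := TDLC.discreteResidual_eq_distalResidual hS hdist
  have herg := TDLC.isErgodicOn_of_discreteResidualOn_eq hS.continuous hres
    TDLC.isInvariant_discreteResidual (TDLC.discreteResidualOn_discreteResidual hS hres)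
  refine ⟨hflat, hnub, hinfty, hinfty.symm.trans heq, ?_⟩
  rw [hnub]
  refine ⟨herg, fun _ => le_antisymm (le_sInf fun D hD => ?_) ?_⟩
  · exact herg.le_of_isDistalAtOneOn hS.continuous hres hD.1 hD.2.2
  · exact heq ▸ TDLC.oneDistalResidual_le_distalResidual

theorem mainTheorem5 {G : Type*} [Group G] [TopologicalSpace G] [IsTopologicalGroup G]
    [T2Space G] [LocallyCompactSpace G] [TotallyDisconnectedSpace G]
    (H K : Subgroup G) (hH : IsClosed (H : Set G)) (hK : IsClosed (K : Set G))
    (hHK : H ≤ Subgroup.normalizer (K : Set G))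
    (hN : ∃ (N : Subgroup H) (_ : N.Normal), IsClosed (N : Set H) ∧
      TDLC.HasSIN ((TDLC.conjAction H K hHK).comp N.subtype) ∧
      TDLC.IsCompactlyGenerated (H ⧸ N)) :
    List.TFAE
      [IsCompact (TDLC.distalResidual (TDLC.conjAction H K hHK) : Set K),
       IsCompact (TDLC.discreteResidual (TDLC.conjAction H K hHK) : Set K),
       ∃ U : Subgroup K, IsCompact (U : Set K) ∧ IsOpen (U : Set K) ∧
         TDLC.IsInvariant (TDLC.conjAction H K hHK) (U : Set K)] ∧
    ((IsCompact (TDLC.distalResidual (TDLC.conjAction H K hHK) : Set K) ∨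
      IsCompact (TDLC.discreteResidual (TDLC.conjAction H K hHK) : Set K) ∨
      ∃ U : Subgroup K, IsCompact (U : Set K) ∧ IsOpen (U : Set K) ∧
         TDLC.IsInvariant (TDLC.conjAction H K hHK) (U : Set K)) →
      TDLC.IsFlat (TDLC.conjAction H K hHK) ∧
      TDLC.nub (TDLC.conjAction H K hHK) = TDLC.discreteResidual (TDLC.conjAction H K hHK) ∧
      TDLC.discreteResidual (TDLC.conjAction H K hHK) =
        TDLC.residualInfty (TDLC.conjAction H K hHK) ∧
      TDLC.residualInfty (TDLC.conjAction H K hHK) =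
        TDLC.distalResidual (TDLC.conjAction H K hHK) ∧
      TDLC.IsErgodicOn (TDLC.conjAction H K hHK) (TDLC.nub (TDLC.conjAction H K hHK)) ∧
      (TopologicalSpace.MetrizableSpace (TDLC.nub (TDLC.conjAction H K hHK)) →
        TDLC.nub (TDLC.conjAction H K hHK) =
          TDLC.oneDistalResidual (TDLC.conjAction H K hHK))) := by
  obtain ⟨N, _, -, hSIN, hcg⟩ := hN
  have : LocallyCompactSpace K := hK.isClosedEmbedding_subtypeVal.locallyCompactSpace
  exact mainTheorem5_general _ (TDLC.continuous_conjAction hHK) N hSIN hcg
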